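/- Let $n\ge 1$, $m\ge 0$, $1\le p<\infty$. Let $\Omega\subset\mathbb{R}^n$ be a bounded connected open set, let $\Omega_0\subset\mathbb{R}^n$ be an open set containing $\overline\Omega$, and let $X=(X_1,\dots,X_m)$ be vector fields $X_j=(c_{j1},\dots,c_{jn})$ on $\mathbb{R}^n$ whose restrictions to $\Omega_0$ are Lipschitz continuous; $X_j$ is identified with the operator $\sum_i c_{ji}\partial_i$. For $x,y\in\mathbb{R}^n$ let $d(x,y)\in[0,\infty]$ be the Carnot–Carathéodory distance, i.e. the infimum of the $T>0$ for which there is an absolutely continuous curve $\gamma:[0,T]\to\mathbb{R}^n$ with $\gamma(0)=x$, $\gamma(T)=y$ and, for a.e. $t\in[0,T]$, $\langle\gamma'(t),\xi\rangle^2\le\sum_{j}\langle X_j(\gamma(t)),\xi\rangle^2$ for all $\xi\in\mathbb{R}^n$ (with $\inf\emptyset=\infty$). Put $B_d(x,r)=\{y\in\Omega_0: d(x,y)<r\}$ and let $|A|$ be the Lebesgue measure of $A$. Assume: (H1) $d(x,y)<\infty$ for all $x,y\in\Omega_0$, and $d$ is continuous on $\Omega_0\times\Omega_0$ for the Euclidean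 topology. (H2) For every compact $K\subset\Omega_0$ there are $r_K>0$ and $C_K>0$ with $|B_d(x,2r)|\le C_K|B_d(x,r)|$ for all $x\in K$ and $0<r<r_K$. (H3) There are constants $c,C>0$ such that for every $x_0$ and $r>0$ with $\{y\in\mathbb{R}^n: d(x_0,y)<cr\}\subset\Omega_0$, writing $B=B_d(x_0,r)$ and $cB=B_d(x_0,cr)$, every function $u$ that is Lipschitz on $\overline{cB}$ and every $x\in\overline B\cap\Omega_0$ satisfy $$\Big|u(x)-\frac1{|B|}\int_B u(y)\,dy\Big|\le C\int_{cB}|Xu(y)|\,\frac{d(x,y)}{|B_d(x,d(x,y))|}\,dy .$$ For $u\in L^1_{\rm loc}(\Omega)$ let $Xu=(X_1u,\dots,X_mu)$ be defined in the sense of distributions, $X_ju(\psi)=-\int_\Omega u\sum_i\partial_i(c_{ji}\psi)\,dx$ for $\psi\in C_c^\infty(\Omega)$; let $W^{1,p}_X(\Omega)=\{u\in L^p(\Omega): X_ju\in L^p(\Omega),\ j=1,\dots,m\}$ with the norm $\big(\int_\Omega|u|^p\,dx+\int_\Omega|Xu|^p\,dx\big)^{1/p}$, and let $W^{1,p}_{X,0}(\Omega)$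 be the closure of $C^1_c(\Omega)\cap W^{1,p}_X(\Omega)$ in $W^{1,p}_X(\Omega)$. Then there is a constant $c_{p,\Omega}>0$ such that $$c_{p,\Omega}\int_\Omega|u|^p\,dx\le\int_\Omega|Xu|^p\,dx\qquad\text{for all }u\in W^{1,p}_{X,0}(\Omega).$$ -/

import Mathlib

open MeasureTheory Set
open scoped ENNReal NNReal

noncomputable section

namespace CarnotCaratheodory

/-- `ℝⁿ` with its Euclidean norm. -/
abbrev E (n : ℕ) : Type := EuclideanSpace ℝ (Fin n)

variable {n m : ℕ}

/-- `γ : [0, T] → ℝⁿ` is a sub-unit curve for `X = (X₁, …, X_m)`: it is absolutely continuous and,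
for a.e. `t ∈ [0, T]`, `⟨γ'(t), ξ⟩² ≤ ∑ⱼ ⟨Xⱼ(γ(t)), ξ⟩²` for every `ξ ∈ ℝⁿ`. -/
structure IsSubunit (X : Fin m → E n → E n) (T : ℝ) (γ : ℝ → E n) : Prop where
  absCont : AbsolutelyContinuousOnInterval γ 0 T
  speed : ∀ᵐ t : ℝ, t ∈ Icc 0 T →
    ∀ ξ : E n, (inner ℝ (deriv γ t) ξ) ^ 2 ≤ ∑ j, (inner ℝ (X j (γ t)) ξ) ^ 2

/-- The Carnot–Carathéodory distance `d(x, y) ∈ [0, ∞]`: the infimum of the times `T > 0` in which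
a sub-unit curve joins `x` to `y` (it is `∞` if there is no such curve). -/
def ccDist (X : Fin m → E n → E n) (x y : E n) : ℝ≥0∞ :=
  sInf {a | ∃ T : ℝ, 0 < T ∧ ∃ γ : ℝ → E n,
    IsSubunit X T γ ∧ γ 0 = x ∧ γ T = y ∧ a = ENNReal.ofReal T}

/-- The open metric ball of `A`: `{y ∈ A | d(x, y) < r}`. -/
def ccBall (X : Fin m → E n → E n) (A : Set (E n)) (x : E n) (r : ℝ≥0∞) : Set (E n) :=
  {y | y ∈ A ∧ ccDist X x y < r}

/-- Condition (H1): `d` is finite and continuous (for the Euclidean topology) on `Ω₀ × Ω₀`. -/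
def CondH1 (X : Fin m → E n → E n) (Ω₀ : Set (E n)) : Prop :=
  (∀ x ∈ Ω₀, ∀ y ∈ Ω₀, ccDist X x y < ∞) ∧
  ContinuousOn (fun z : E n × E n => ccDist X z.1 z.2) (Ω₀ ×ˢ Ω₀)

/-- Condition (H2): the Lebesgue measure is doubling on small metric balls centred in a compact
subset of `Ω₀`. -/
def CondH2 (X : Fin m → E n → E n) (Ω₀ : Set (E n)) : Prop :=
  ∀ K : Set (E n), IsCompact K → K ⊆ Ω₀ →
    ∃ rK : ℝ, 0 < rK ∧ ∃ CK : ℝ, 0 < CK ∧ ∀ x ∈ K, ∀ r : ℝ, 0 < r → r < rK →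
      volume (ccBall X Ω₀ x (ENNReal.ofReal (2 * r))) ≤
        ENNReal.ofReal CK * volume (ccBall X Ω₀ x (ENNReal.ofReal r))

/-- `Xu(y) = (X₁u(y), …, X_m u(y))`, where `Xⱼu(y) = ∑ᵢ cⱼᵢ(y) ∂ᵢu(y)`, at a point `y` of
differentiability of `u` (almost every point if `u` is Lipschitz). -/
def classicalGrad (X : Fin m → E n → E n) (u : E n → ℝ) (y : E n) : E m :=
  WithLp.toLp 2 (fun j => fderiv ℝ u y (X j y))

/-- Condition (H3): the representation formula. There are `c, C > 0` such that for every metric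
ball `B = B_d(x₀, r)` such that all points of `ℝⁿ` at distance less than `c r` from `x₀` lie in
`Ω₀`, every `u` that is Lipschitz on the closure of `cB` and every `x` in the closure of `B`
in `Ω₀`,
`|u(x) - ⨍_B u| ≤ C ∫_{cB} |Xu(y)| d(x, y) / |B_d(x, d(x, y))| dy`.
The integrand on the right is nonnegative and its integral may be `∞`. -/
def CondH3 (X : Fin m → E n → E n) (Ω₀ : Set (E n)) : Prop :=
  ∃ c C : ℝ, 0 < c ∧ 0 < C ∧ ∀ (x₀ : E n) (r : ℝ), 0 < r →
    ccBall X univ x₀ (ENNReal.ofReal (c * r)) ⊆ Ω₀ →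
    ∀ u : E n → ℝ,
      (∃ L : ℝ≥0, LipschitzOnWith L u (closure (ccBall X Ω₀ x₀ (ENNReal.ofReal (c * r))))) →
      ∀ x ∈ closure (ccBall X Ω₀ x₀ (ENNReal.ofReal r)) ∩ Ω₀,
        ENNReal.ofReal |u x - ⨍ y in ccBall X Ω₀ x₀ (ENNReal.ofReal r), u y| ≤
          ENNReal.ofReal C * ∫⁻ y in ccBall X Ω₀ x₀ (ENNReal.ofReal (c * r)),
            ‖classicalGrad X u y‖ₑ *
              (ccDist X x y / volume (ccBall X Ω₀ x (ccDist X x y)))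

/-- `V = Xu` in the sense of distributions on `Ω`: `u` and `V` are locally integrable on `Ω` and
`∫_Ω Vⱼ ψ = - ∫_Ω u ∑ᵢ ∂ᵢ(cⱼᵢ ψ)` for every `j` and every test function `ψ ∈ C_c^∞(Ω)`, where
`cⱼᵢ` is the `i`-th coordinate of `Xⱼ`. (The functions `cⱼᵢ ψ` are Lipschitz, so that their partial
derivatives exist almost everywhere.) -/
structure IsWeakGrad (X : Fin m → E n → E n) (Ω : Set (E n)) (u : E n → ℝ) (V : E n → E m) :
    Prop where
  locInt : LocallyIntegrableOn u Ω
  locInt_grad : LocallyIntegrableOn V Ω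
  integral_eq : ∀ ψ : E n → ℝ, ContDiff ℝ (⊤ : ℕ∞) ψ → HasCompactSupport ψ → tsupport ψ ⊆ Ω →
    ∀ j : Fin m, ∫ x in Ω, V x j * ψ x =
      - ∫ x in Ω, u x *
        ∑ i : Fin n, fderiv ℝ (fun y => X j y i * ψ y) x (EuclideanSpace.single i 1)

open Classical in
/-- The distributional gradient `Xu` on `Ω`, as a function, when it is one (`0` otherwise). It is
unique up to a null set of `Ω`. -/
def weakGrad (X : Fin m → E n → E n) (Ω : Set (E n)) (u : E n → ℝ) : E n → E m :=
  if h : ∃ V : E n → E m, IsWeakGrad X Ω u V then h.choose else 0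

/-- `u ∈ W^{1,p}_X(Ω)`: `u ∈ L^p(Ω)` and the distribution `Xu` is a function in `L^p(Ω; ℝᵐ)`. -/
def MemW (X : Fin m → E n → E n) (Ω : Set (E n)) (p : ℝ) (u : E n → ℝ) : Prop :=
  MemLp u (ENNReal.ofReal p) (volume.restrict Ω) ∧
  ∃ V : E n → E m, IsWeakGrad X Ω u V ∧ MemLp V (ENNReal.ofReal p) (volume.restrict Ω)

/-- The norm `(∫_Ω |u|^p + ∫_Ω |Xu|^p)^{1/p}` of `W^{1,p}_X(Ω)`. -/
def normW (X : Fin m → E n → E n) (Ω : Set (E n)) (p : ℝ) (u : E n → ℝ) : ℝ :=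
  ((∫ x in Ω, |u x| ^ p) + ∫ x in Ω, ‖weakGrad X Ω u x‖ ^ p) ^ (1 / p)

/-- `u ∈ W^{1,p}_{X,0}(Ω)`: `u` lies in the closure of `C¹_c(Ω) ∩ W^{1,p}_X(Ω)` in
`W^{1,p}_X(Ω)`. -/
def MemW0 (X : Fin m → E n → E n) (Ω : Set (E n)) (p : ℝ) (u : E n → ℝ) : Prop :=
  MemW X Ω p u ∧ ∀ ε : ℝ, 0 < ε → ∃ φ : E n → ℝ,
    ContDiff ℝ 1 φ ∧ HasCompactSupport φ ∧ tsupport φ ⊆ Ω ∧ MemW X Ω p φ ∧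
    normW X Ω p (fun x => u x - φ x) < ε

end CarnotCaratheodory

end

/-!
The inequality is proved for `u ∈ C¹_c(Ω)` by spreading a local Poincaré inequality along `Ω`, and
then passes to the closure; no compact embedding is needed.

*Local Poincaré inequality* (`exists_local_poincare`). On a small metric ball `B`, condition (H3)
bounds `|u - u_B|` by the integral operator with kernel `K(x, y) = d(x, y) / |B_d(x, d(x, y))|`
applied to `|Xu|`. By doubling, each dyadic annulus around `x` contributes a constant times its
radius to `∫ K(x, y) dy` (`lintegral_ccKernel_le`), and `K(x, y) ≤ C K(y, x)` by the triangle
inequality for `d` (`ccKernel_le_mul_swap`). Hence both marginal integrals of `K` are bounded, and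
Schur's test bounds the oscillation of `u` in `L^p(B)` by `Xu` in `L^p`. That (H3) applies to small
balls uses that metric balls in `ℝⁿ` shrink to their centre in the Euclidean sense
(`exists_ccBall_subset`): a sub-unit curve has bounded speed as long as it stays in a compact
subset of `Ω₀`.

*Spreading* (`hasBoundOn_closure`). If `∫_W |u|^p ≤ C ∫ |Xu|^p` for all `u ∈ C¹_c(Ω)` on an open
nonempty part `W` of such a `B`, then the mean value of `u` on `B` is controlled, so the bound holds
on `B`. Near a boundary point of `closure Ω` it holds because `u` vanishes on the complement of
`closure Ω`, which is open and meets `B`. (Boundary points of `Ω` would not do: `B \ Ω` may be a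
null set.) Connectedness of `closure Ω` carries the bound to every point, and compactness makes the constant uniform.

*Closure* (`integral_rpow_le_of_memW0`). Integration by parts for Lipschitz functions identifies the
classical and the weak gradient of `u ∈ C¹_c(Ω)`, and weak gradients are unique and additive, so the
inequality is stable under convergence in `W^{1,p}_X(Ω)`.
-/

open scoped Topology

namespace CarnotCaratheodory

/-! ### The Carnot–Carathéodory distance -/

/-- Absolute continuity is preserved by a monotone or antitone change of parameter that does not
increase distances, since such a map sends disjoint intervals to disjoint intervals. -/
lemma _root_.AbsolutelyContinuousOnInterval.comp_of_monotone_or_antitone {Y : Type*}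
    [PseudoMetricSpace Y] {f : ℝ → Y} {φ : ℝ → ℝ} {a b c d : ℝ}
    (hf : AbsolutelyContinuousOnInterval f c d)
    (hφ : Monotone φ ∨ Antitone φ) (hL : LipschitzWith 1 φ)
    (hmaps : ∀ t ∈ uIcc a b, φ t ∈ uIcc c d) :
    AbsolutelyContinuousOnInterval (fun t => f (φ t)) a b := by
  rw [absolutelyContinuousOnInterval_iff] at hf ⊢
  intro ε hε
  obtain ⟨δ, hδ, h⟩ := hf ε hε
  refine ⟨δ, hδ, fun I hI hlen => ?_⟩
  refine h (I.1, fun i => (φ (I.2 i).1, φ (I.2 i).2)) ⟨fun i hi => ?_, ?_⟩ ?_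
  · exact ⟨hmaps _ (hI.1 i hi).1, hmaps _ (hI.1 i hi).2⟩
  · intro i hi j hj hij
    have := hI.2 hi hj hij
    simp only [Function.onFun, uIoc, Ioc_disjoint_Ioc] at this ⊢
    rcases hφ with hφ | hφ
    · simp only [← hφ.map_max, ← hφ.map_min]
      exact hφ this
    · simp only [← hφ.map_max, ← hφ.map_min]
      exact hφ this
  · refine lt_of_le_of_lt (Finset.sum_le_sum fun i _ => ?_) hlen
    simpa using hL.dist_le_mul (I.2 i).1 (I.2 i).2

variable {n m : ℕ} {X : Fin m → E n → E n} {Ω Ω₀ : Set (E n)}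

lemma ccDist_le {T : ℝ} (hT : 0 < T) {γ : ℝ → E n} (h : IsSubunit X T γ) :
    ccDist X (γ 0) (γ T) ≤ ENNReal.ofReal T :=
  sInf_le ⟨T, hT, γ, h, rfl, rfl, rfl⟩

lemma exists_of_ccDist_lt {x y : E n} {r : ℝ≥0∞} (h : ccDist X x y < r) :
    ∃ T : ℝ, 0 < T ∧ ENNReal.ofReal T < r ∧ ∃ γ : ℝ → E n,
      IsSubunit X T γ ∧ γ 0 = x ∧ γ T = y := by
  obtain ⟨_, ⟨T, hT, γ, hγ, h0, h1, rfl⟩, hr⟩ := sInf_lt_iff.1 h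
  exact ⟨T, hT, hr, γ, hγ, h0, h1⟩

lemma ccDist_self (x : E n) : ccDist X x x = 0 := by
  refine le_antisymm (le_of_forall_pos_le_add fun ε hε => ?_) zero_le
  by_cases hε' : ε = ∞
  · simp [hε']
  have hp : 0 < ε.toReal := ENNReal.toReal_pos hε.ne' hε'
  have hs : IsSubunit X ε.toReal (fun _ => x) := by
    refine ⟨?_, Filter.Eventually.of_forall fun t _ ξ => ?_⟩
    · exact (LipschitzWith.const x).lipschitzOnWith.absolutelyContinuousOnInterval
    · simp only [deriv_const, inner_zero_left]
      simpa using Finset.sum_nonneg fun j (_ : j ∈ Finset.univ) => sq_nonneg (inner ℝ (X j x) ξ)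
  simpa [ENNReal.ofReal_toReal hε'] using ccDist_le hp hs

lemma IsSubunit.reverse {T : ℝ} {γ : ℝ → E n} (hT : 0 < T) (h : IsSubunit X T γ) :
    IsSubunit X T (fun t => γ (T - t)) := by
  refine ⟨h.absCont.comp_of_monotone_or_antitone (Or.inr fun a b hab => sub_le_sub_left hab T)
    ?_ ?_, ?_⟩
  · exact LipschitzWith.of_dist_le_mul fun a b => by simp [dist_eq_norm]; rw [abs_sub_comm]
  · intro t ht
    rw [uIcc_of_le hT.le] at ht ⊢
    exact ⟨by linarith [ht.2], by linarith [ht.1]⟩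
  · have := (Measure.measurePreserving_sub_left volume T).quasiMeasurePreserving.ae h.speed
    filter_upwards [this] with t ht htT ξ
    rw [deriv_comp_const_sub]
    simpa using ht ⟨by linarith [htT.2], by linarith [htT.1]⟩ ξ

lemma ccDist_comm (x y : E n) : ccDist X x y = ccDist X y x := by
  have key : ∀ x y : E n, ccDist X y x ≤ ccDist X x y := fun x y => by
    refine le_of_forall_gt fun r hr => ?_
    obtain ⟨T, hT, hTr, γ, hγ, rfl, rfl⟩ := exists_of_ccDist_lt hr
    have := ccDist_le hT (hγ.reverse hT)
    simp only [sub_zero, sub_self] at this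
    exact this.trans_lt hTr
  exact le_antisymm (key y x) (key x y)

/-- The curve that follows `γ₁` on `[0, T₁]` and then `γ₂`. It is written without case
distinction, so that its absolute continuity comes from that of compositions and sums. -/
lemma IsSubunit.concat {T₁ T₂ : ℝ} {γ₁ γ₂ : ℝ → E n} (hT₁ : 0 < T₁) (hT₂ : 0 < T₂)
    (h₁ : IsSubunit X T₁ γ₁) (h₂ : IsSubunit X T₂ γ₂) (h : γ₁ T₁ = γ₂ 0) :
    IsSubunit X (T₁ + T₂) (fun t => γ₁ (min t T₁) + (γ₂ (max (t - T₁) 0) - γ₁ T₁)) := by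
  refine ⟨?_, ?_⟩
  · refine AbsolutelyContinuousOnInterval.fun_add ?_ (AbsolutelyContinuousOnInterval.fun_sub ?_ ?_)
    · refine h₁.absCont.comp_of_monotone_or_antitone (Or.inl fun a b hab => min_le_min_right _ hab)
        (LipschitzWith.id.min_const T₁) fun t ht => ?_
      rw [uIcc_of_le (by linarith)] at ht ⊢
      exact ⟨le_min ht.1 hT₁.le, min_le_right _ _⟩
    · refine h₂.absCont.comp_of_monotone_or_antitone
        (Or.inl fun a b hab => max_le_max_right _ (by linarith))
        (LipschitzWith.max_const (LipschitzWith.of_dist_le_mul fun a b => by simp) 0) fun t ht => ?_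
      rw [uIcc_of_le (by linarith)] at ht ⊢
      exact ⟨le_max_right _ _, max_le (by linarith [ht.2]) hT₂.le⟩
    · exact ((LipschitzWith.const (γ₁ T₁)).lipschitzOnWith).absolutelyContinuousOnInterval
  · have h2 := (measurePreserving_sub_right volume T₁).quasiMeasurePreserving.ae h₂.speed
    have h3 : ∀ᵐ t : ℝ, t ≠ T₁ := by simp [ae_iff]
    filter_upwards [h₁.speed, h2, h3] with t ht₁ ht₂ hne ht ξ
    rcases lt_or_gt_of_ne hne with hlt | hlt
    · have heq : (fun t => γ₁ (min t T₁) + (γ₂ (max (t - T₁) 0) - γ₁ T₁)) =ᶠ[𝓝 t] γ₁ := by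
        filter_upwards [eventually_lt_nhds hlt] with s hs
        rw [min_eq_left hs.le, max_eq_right (by linarith), h]; simp
      rw [heq.deriv_eq, heq.eq_of_nhds]
      exact ht₁ ⟨ht.1, hlt.le⟩ ξ
    · have heq : (fun t => γ₁ (min t T₁) + (γ₂ (max (t - T₁) 0) - γ₁ T₁))
          =ᶠ[𝓝 t] fun s => γ₂ (s - T₁) := by
        filter_upwards [eventually_gt_nhds hlt] with s hs
        rw [min_eq_right hs.le, max_eq_left (by linarith)]; simp
      rw [heq.deriv_eq, heq.eq_of_nhds, deriv_comp_sub_const]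
      exact ht₂ ⟨by linarith, by linarith [ht.2]⟩ ξ

lemma ccDist_triangle (x y z : E n) : ccDist X x z ≤ ccDist X x y + ccDist X y z := by
  refine ENNReal.le_of_forall_pos_le_add fun ε hε hfin => ?_
  have hε2 : (0 : ℝ≥0∞) < ε / 2 := by simpa using hε.ne'
  obtain ⟨h1, h2⟩ := ENNReal.add_lt_top.1 hfin
  obtain ⟨S, hS, hSr, γ, hγ, rfl, rfl⟩ :=
    exists_of_ccDist_lt (ENNReal.lt_add_right h1.ne hε2.ne')
  obtain ⟨T, hT, hTr, γ', hγ', h0, rfl⟩ :=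
    exists_of_ccDist_lt (ENNReal.lt_add_right h2.ne hε2.ne')
  have := ccDist_le (by positivity) (hγ.concat hS hT hγ' h0.symm)
  simp only [min_eq_left hS.le, zero_sub, add_sub_cancel_left] at this
  rw [max_eq_right (by linarith), max_eq_left hT.le, min_eq_right (by linarith), h0] at this
  simp only [sub_self, add_zero, add_sub_cancel] at this
  refine this.trans ?_
  rw [ENNReal.ofReal_add hS.le hT.le]
  refine (add_le_add hSr.le hTr.le).trans (le_of_eq ?_)
  rw [add_add_add_comm, ENNReal.add_halves]

/-- A sub-unit curve moves by at most `M t` in time `t` if `|X|` is at most `M` along it. The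
fundamental theorem of calculus is applied to the component in the direction `γ t - γ 0`. -/
lemma norm_sub_le_of_subunit {T t M : ℝ} {γ : ℝ → E n} (h : IsSubunit X T γ)
    (ht : t ∈ Icc 0 T) (hM : 0 ≤ M) (hX : ∀ s ∈ Icc 0 t, ∑ j, ‖X j (γ s)‖ ^ 2 ≤ M ^ 2) :
    ‖γ t - γ 0‖ ≤ M * t := by
  set ξ := γ t - γ 0 with hξ
  have hac : AbsolutelyContinuousOnInterval γ 0 t := h.absCont.mono (by
    rw [uIcc_of_le ht.1, uIcc_of_le (ht.1.trans ht.2)]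
    exact Icc_subset_Icc_right ht.2)
  have hac' : AbsolutelyContinuousOnInterval (fun s => inner ℝ ξ (γ s)) 0 t := by
    have hs := Filter.Tendsto.const_mul ‖ξ‖ hac
    rw [mul_zero] at hs
    refine squeeze_zero (fun _ => Finset.sum_nonneg fun _ _ => dist_nonneg) (fun I => ?_) hs
    rw [Finset.mul_sum]
    refine Finset.sum_le_sum fun i _ => ?_
    rw [dist_eq_norm, dist_eq_norm, ← inner_sub_right]
    exact norm_inner_le_norm _ _
  have hd : ∀ᵐ s : ℝ, s ∈ uIcc 0 t → DifferentiableAt ℝ γ s :=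
    hac.boundedVariationOn.ae_differentiableAt_of_mem_uIcc
  have hFTC := hac'.integral_deriv_eq_sub
  rw [← inner_sub_right, ← hξ] at hFTC
  have hb : ∀ᵐ s : ℝ, s ∈ uIoc 0 t → ‖deriv (fun s => inner ℝ ξ (γ s)) s‖ ≤ M * ‖ξ‖ := by
    filter_upwards [hd, h.speed] with s hs hsp hst
    rw [uIoc_of_le ht.1] at hst
    rw [uIcc_of_le ht.1] at hs
    have hst' : s ∈ Icc 0 t := Ioc_subset_Icc_self hst
    have hder : deriv (fun s => inner ℝ ξ (γ s)) s = inner ℝ (deriv γ s) ξ := by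
      have := ((hasDerivAt_const s ξ).inner ℝ (hs hst').hasDerivAt).deriv
      rw [this]; simp [real_inner_comm]
    rw [hder]
    refine abs_le_of_sq_le_sq ?_ (by positivity)
    refine (hsp ⟨hst'.1, hst'.2.trans ht.2⟩ ξ).trans ?_
    rw [mul_pow]
    refine le_trans ?_ (mul_le_mul_of_nonneg_right (hX s hst') (sq_nonneg _))
    rw [Finset.sum_mul]
    refine Finset.sum_le_sum fun j _ => ?_
    rw [← mul_pow, ← sq_abs]
    exact pow_le_pow_left₀ (abs_nonneg _) (abs_real_inner_le_norm _ _) 2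
  have := intervalIntegral.norm_integral_le_of_norm_le_const_ae hb
  rw [hFTC, real_inner_self_eq_norm_sq, sub_zero, abs_of_nonneg ht.1, Real.norm_eq_abs,
    abs_of_nonneg (by positivity)] at this
  by_cases h0 : ‖ξ‖ = 0
  · rw [h0]; exact mul_nonneg hM ht.1
  · have hpos : 0 < ‖ξ‖ := lt_of_le_of_ne (norm_nonneg _) (Ne.symm h0)
    nlinarith

/-- Small metric balls in all of `ℝⁿ` are contained in small Euclidean balls: a sub-unit curve
needs a certain time to leave a Euclidean ball on which the vector fields are bounded. -/
lemma exists_ccBall_subset {x₀ : E n} {ρ : ℝ} (hρ : 0 < ρ)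
    (hX : ∀ j, ContinuousOn (X j) (Metric.closedBall x₀ ρ)) :
    ∃ δ : ℝ, 0 < δ ∧ ccBall X univ x₀ (ENNReal.ofReal δ) ⊆ Metric.closedBall x₀ ρ := by
  have hc : ContinuousOn (fun x => ∑ j, ‖X j x‖ ^ 2) (Metric.closedBall x₀ ρ) :=
    continuousOn_finsetSum _ fun j _ => (hX j).norm.pow 2
  obtain ⟨M, hM⟩ := (isCompact_closedBall x₀ ρ).exists_bound_of_continuousOn hc
  have hM0 : 0 ≤ M := (norm_nonneg _).trans (hM x₀ (Metric.mem_closedBall_self hρ.le))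
  refine ⟨ρ / (M + 1), by positivity, fun y hy => ?_⟩
  obtain ⟨T, hT, hTr, γ, hγ, rfl, rfl⟩ := exists_of_ccDist_lt hy.2
  have hTr' : T < ρ / (M + 1) := (ENNReal.ofReal_lt_ofReal_iff (by positivity)).1 hTr
  rw [lt_div_iff₀ (by positivity)] at hTr'
  by_contra hout
  have hcont : ContinuousOn (fun t => dist (γ t) (γ 0)) (Icc 0 T) := by
    have hc : ContinuousOn γ (Icc 0 T) := by
      simpa only [uIcc_of_le hT.le] using hγ.absCont.continuousOn
    fun_prop
  have hcomp : IsCompact (Icc 0 T ∩ (fun t => dist (γ t) (γ 0)) ⁻¹' Ici ρ) :=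
    isCompact_Icc.of_isClosed_subset (hcont.preimage_isClosed_of_isClosed isClosed_Icc isClosed_Ici)
      inter_subset_left
  have hne : (Icc 0 T ∩ (fun t => dist (γ t) (γ 0)) ⁻¹' Ici ρ).Nonempty :=
    ⟨T, ⟨hT.le, le_rfl⟩, le_of_lt (by simpa using hout)⟩
  obtain ⟨τ, ⟨hτT, hτ⟩, hmin⟩ := hcomp.exists_isLeast hne
  -- before the exit time `τ` the curve stays in the ball, and at `τ` it is still in it
  have hin : ∀ s ∈ Icc 0 τ, γ s ∈ Metric.closedBall (γ 0) ρ := by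
    have hlt : ∀ s ∈ Ico 0 τ, dist (γ s) (γ 0) ≤ ρ := fun s hs => by
      by_contra hcon
      exact absurd (hmin ⟨⟨hs.1, hs.2.le.trans hτT.2⟩, le_of_lt (not_le.1 hcon)⟩) (not_le.2 hs.2)
    have hτ0 : τ ≠ 0 := by
      rintro rfl
      simp only [mem_preimage, dist_self, mem_Ici] at hτ
      linarith
    intro s hs
    have hsub : closure (Ico 0 τ) ⊆ Icc 0 T ∩ (fun t => dist (γ t) (γ 0)) ⁻¹' Iic ρ :=
      closure_minimal (fun s hs => ⟨⟨hs.1, hs.2.le.trans hτT.2⟩, hlt s hs⟩)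
        (hcont.preimage_isClosed_of_isClosed isClosed_Icc isClosed_Iic)
    rw [closure_Ico hτ0.symm] at hsub
    exact (hsub hs).2
  have hle := norm_sub_le_of_subunit hγ hτT (M := M + 1) (by positivity) fun s hs =>
    (le_abs_self _).trans ((hM _ (hin s hs)).trans (by nlinarith))
  rw [← dist_eq_norm] at hle
  have : ρ ≤ (M + 1) * τ := le_trans hτ hle
  nlinarith [hτT.2]

/-! ### Schur's test -/

/-- **Schur's test**: if the integrals of a nonnegative kernel in each variable are at most `M`,
then the integral operator has norm at most `M` on `L^p`. -/
lemma lintegral_rpow_lintegral_mul_le {α β : Type*} [MeasurableSpace α] [MeasurableSpace β]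
    {μ : Measure α} {ν : Measure β} [SFinite μ] [SFinite ν] {K : α → β → ℝ≥0∞}
    (hK : AEMeasurable (Function.uncurry K) (μ.prod ν)) {g : β → ℝ≥0∞} (hg : AEMeasurable g ν)
    {p : ℝ} (hp : 1 ≤ p) {M : ℝ≥0∞} (hM : M ≠ ∞) (h₁ : ∀ᵐ x ∂μ, ∫⁻ y, K x y ∂ν ≤ M)
    (h₂ : ∀ᵐ y ∂ν, ∫⁻ x, K x y ∂μ ≤ M) :
    ∫⁻ x, (∫⁻ y, g y * K x y ∂ν) ^ p ∂μ ≤ M ^ p * ∫⁻ y, g y ^ p ∂ν := by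
  have hp0 : 0 < p := by linarith
  have hp1 : 0 ≤ 1 - 1 / p := by
    rw [sub_nonneg, div_le_one hp0]; exact hp
  have hMp : M ^ (p - 1) ≠ ∞ := ENNReal.rpow_ne_top_of_nonneg (by linarith) hM
  have hsec : ∀ᵐ x ∂μ, AEMeasurable (K x) ν := by
    filter_upwards [hK.aestronglyMeasurable.prodMk_left] with x hx using hx.aemeasurable
  -- Hölder's inequality for the measure `K x y dy`
  have hold : ∀ᵐ x ∂μ, (∫⁻ y, g y * K x y ∂ν) ^ p ≤ M ^ (p - 1) * ∫⁻ y, g y ^ p * K x y ∂ν := by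
    filter_upwards [hsec, h₁] with x hx hxM
    have h := ENNReal.lintegral_mul_norm_pow_le (f := fun y => g y ^ p * K x y) (g := K x)
      ((hg.pow_const p).mul hx) hx (p := 1 / p) (q := 1 - 1 / p) (by positivity) hp1 (by ring)
    have heq : ∀ y, (g y ^ p * K x y) ^ (1 / p) * K x y ^ (1 - 1 / p) = g y * K x y := fun y => by
      rw [ENNReal.mul_rpow_of_nonneg _ _ (by positivity), ← ENNReal.rpow_mul,
        mul_one_div_cancel hp0.ne', ENNReal.rpow_one, mul_assoc,
        ← ENNReal.rpow_add_of_nonneg _ _ (by positivity) hp1, add_sub_cancel, ENNReal.rpow_one]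
    simp only [heq] at h
    refine (ENNReal.rpow_le_rpow h hp0.le).trans ?_
    rw [ENNReal.mul_rpow_of_nonneg _ _ hp0.le, ← ENNReal.rpow_mul, ← ENNReal.rpow_mul,
      one_div_mul_cancel hp0.ne', ENNReal.rpow_one, sub_mul, one_div_mul_cancel hp0.ne', one_mul,
      mul_comm]
    gcongr
  have hgK : AEMeasurable (Function.uncurry fun x y => g y ^ p * K x y) (μ.prod ν) :=
    ((hg.pow_const p).comp_snd).mul hK
  have hsec₂ : ∀ᵐ y ∂ν, AEMeasurable (fun x => K x y) μ := by
    have := hK.prod_swap.aestronglyMeasurable.prodMk_left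
    filter_upwards [this] with y hy using hy.aemeasurable
  calc ∫⁻ x, (∫⁻ y, g y * K x y ∂ν) ^ p ∂μ
      ≤ ∫⁻ x, M ^ (p - 1) * ∫⁻ y, g y ^ p * K x y ∂ν ∂μ := lintegral_mono_ae hold
    _ = M ^ (p - 1) * ∫⁻ y, ∫⁻ x, g y ^ p * K x y ∂μ ∂ν := by
        rw [lintegral_const_mul' _ _ hMp, lintegral_lintegral_swap hgK]
    _ ≤ M ^ (p - 1) * ∫⁻ y, M * g y ^ p ∂ν := by
        gcongr 1
        refine lintegral_mono_ae ?_
        filter_upwards [h₂, hsec₂] with y hy hmy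
        rw [lintegral_const_mul'' _ hmy, mul_comm]
        gcongr
    _ = M ^ p * ∫⁻ y, g y ^ p ∂ν := by
        rw [lintegral_const_mul' _ _ hM, ← mul_assoc]
        congr 1
        nth_rewrite 2 [← ENNReal.rpow_one M]
        rw [← ENNReal.rpow_add_of_nonneg _ _ (by linarith) zero_le_one, sub_add_cancel]

/-! ### The kernel of the representation formula -/

/-- The kernel `d(x, y) / |B_d(x, d(x, y))|` of the representation formula. It vanishes where
`d(x, y) = 0`, whatever the volume of the (empty) ball is, because `0 / 0 = 0` in `ℝ≥0∞`. -/
noncomputable def ccKernel (X : Fin m → E n → E n) (Ω₀ : Set (E n)) (x y : E n) : ℝ≥0∞ :=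
  ccDist X x y / volume (ccBall X Ω₀ x (ccDist X x y))

lemma isOpen_ccBall (hΩ₀ : IsOpen Ω₀) (h1 : CondH1 X Ω₀) {x : E n} (hx : x ∈ Ω₀) (r : ℝ≥0∞) :
    IsOpen (ccBall X Ω₀ x r) := by
  have hc : ContinuousOn (fun y => ccDist X x y) Ω₀ :=
    h1.2.comp (f := fun y => (x, y)) (by fun_prop) fun y hy => ⟨hx, hy⟩
  exact hc.isOpen_inter_preimage hΩ₀ isOpen_Iio

lemma aemeasurable_ccKernel (hΩ₀ : IsOpen Ω₀) (h1 : CondH1 X Ω₀) {A B : Set (E n)}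
    (hA : A ⊆ Ω₀) (hB : B ⊆ Ω₀) :
    AEMeasurable (Function.uncurry (ccKernel X Ω₀))
      ((volume.restrict A).prod (volume.restrict B)) := by
  rw [Measure.prod_restrict]
  refine AEMeasurable.mono_measure ?_ (Measure.restrict_mono (prod_mono hA hB) le_rfl)
  have hms : MeasurableSet (Ω₀ ×ˢ Ω₀) := (hΩ₀.prod hΩ₀).measurableSet
  refine AEMeasurable.div (h1.2.aemeasurable hms) ?_
  -- the volume of the ball is the measure of a section of the open set `W`
  let W : Set ((E n × E n) × E n) := ((Ω₀ ×ˢ Ω₀) ×ˢ Ω₀) ∩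
    {w | ccDist X w.1.1 w.2 < ccDist X w.1.1 w.1.2}
  have hW : IsOpen W := by
    have hc : ContinuousOn (fun w : (E n × E n) × E n =>
        (ccDist X w.1.1 w.2, ccDist X w.1.1 w.1.2)) ((Ω₀ ×ˢ Ω₀) ×ˢ Ω₀) :=
      (h1.2.comp (f := fun w : (E n × E n) × E n => (w.1.1, w.2)) (by fun_prop)
        fun w hw => ⟨hw.1.1, hw.2⟩).prodMk
      (h1.2.comp (f := fun w : (E n × E n) × E n => w.1) (by fun_prop) fun w hw => hw.1)
    exact hc.isOpen_inter_preimage ((hΩ₀.prod hΩ₀).prod hΩ₀) isOpen_lt_prod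
  refine (measurable_measure_prodMk_left (ν := volume) hW.measurableSet).aemeasurable.congr ?_
  filter_upwards [ae_restrict_mem hms] with z hz
  congr 1
  ext w
  exact ⟨fun h => ⟨h.1.2, h.2⟩, fun h => ⟨⟨hz, h.1⟩, h.2⟩⟩

/-- The integral of the kernel over a ball whose radius is in the range of the doubling condition:
each dyadic annulus contributes at most a constant times its radius. -/
lemma lintegral_ccKernel_le (hΩ₀ : IsOpen Ω₀) (h1 : CondH1 X Ω₀) {x : E n} (hx : x ∈ Ω₀)
    {R : ℝ} (hR : 0 < R) {C : ℝ≥0∞}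
    (hC : ∀ r : ℝ, 0 < r → r < R → volume (ccBall X Ω₀ x (ENNReal.ofReal (2 * r))) ≤
      C * volume (ccBall X Ω₀ x (ENNReal.ofReal r))) :
    ∫⁻ y in ccBall X Ω₀ x (ENNReal.ofReal R), ccKernel X Ω₀ x y ≤ C * (ENNReal.ofReal R * 2) := by
  let b : ℕ → Set (E n) := fun k => ccBall X Ω₀ x (ENNReal.ofReal (R / 2 ^ k))
  have hb : ∀ k, MeasurableSet (b k) := fun k => (isOpen_ccBall hΩ₀ h1 hx _).measurableSet
  -- the points at distance zero form `⋂ k, b k`, and the other ones lie in dyadic annuli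
  have hcover : ccBall X Ω₀ x (ENNReal.ofReal R) ⊆ (⋂ k, b k) ∪ ⋃ k, b k \ b (k + 1) := by
    intro y hy
    by_cases h : ∀ k, y ∈ b k
    · exact Or.inl (mem_iInter.2 h)
    · right
      push Not at h
      classical
      have hs := Nat.find_spec h
      obtain ⟨k, hk⟩ : ∃ k, Nat.find h = k + 1 := by
        refine Nat.exists_eq_succ_of_ne_zero fun h0 => hs ?_
        rw [h0]
        simpa [b] using hy
      refine mem_iUnion.2 ⟨k, not_not.1 (Nat.find_min h (by omega)), ?_⟩
      rwa [← hk]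
  have hzero : ∫⁻ y in ⋂ k, b k, ccKernel X Ω₀ x y = 0 := by
    rw [← nonpos_iff_eq_zero]
    refine (setLIntegral_mono' (MeasurableSet.iInter hb) (g := fun _ => 0) fun y hy => ?_).trans
      (by simp)
    have h0 : ccDist X x y = 0 := by
      have ht : Filter.Tendsto (fun k : ℕ => ENNReal.ofReal (R / 2 ^ k)) Filter.atTop (𝓝 0) := by
        have : Filter.Tendsto (fun k : ℕ => R * (1 / 2 : ℝ) ^ k) Filter.atTop (𝓝 (R * 0)) :=
          (tendsto_pow_atTop_nhds_zero_of_lt_one (by norm_num) (by norm_num)).const_mul R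
        have := ENNReal.tendsto_ofReal this
        simpa [div_eq_mul_inv] using this
      exact le_antisymm (ge_of_tendsto' ht fun k => (mem_iInter.1 hy k).2.le) zero_le
    simp [ccKernel, h0]
  have hann : ∀ k, ∫⁻ y in b k \ b (k + 1), ccKernel X Ω₀ x y ≤
      C * (ENNReal.ofReal R * (2⁻¹) ^ k) := fun k => by
    have hρ : ENNReal.ofReal (R / 2 ^ k) = ENNReal.ofReal R * (2⁻¹) ^ k := by
      rw [div_eq_mul_inv, ENNReal.ofReal_mul hR.le, ← inv_pow, ENNReal.ofReal_pow (by positivity),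
        ENNReal.ofReal_inv_of_pos (by norm_num)]
      simp
    rw [← hρ]
    have hdbl : volume (b k) ≤ C * volume (b (k + 1)) := by
      have := hC (R / 2 ^ (k + 1)) (by positivity) (by
        rw [div_lt_iff₀ (by positivity)]
        have : (1 : ℝ) < 2 ^ (k + 1) := one_lt_pow₀ (by norm_num) (by omega)
        nlinarith)
      rwa [show 2 * (R / 2 ^ (k + 1)) = R / 2 ^ k by rw [pow_succ]; field_simp] at this
    calc ∫⁻ y in b k \ b (k + 1), ccKernel X Ω₀ x y
        ≤ ∫⁻ y in b k \ b (k + 1), ENNReal.ofReal (R / 2 ^ k) / volume (b (k + 1)) := by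
          refine setLIntegral_mono' ((hb k).diff (hb _)) fun y hy => ?_
          have hle : ENNReal.ofReal (R / 2 ^ (k + 1)) ≤ ccDist X x y :=
            not_lt.1 fun h => hy.2 ⟨hy.1.1, h⟩
          exact ENNReal.div_le_div hy.1.2.le (measure_mono fun z hz => ⟨hz.1, hz.2.trans_le hle⟩)
      _ ≤ ENNReal.ofReal (R / 2 ^ k) / volume (b (k + 1)) * volume (b k) := by
          rw [setLIntegral_const]
          gcongr
          exact sdiff_subset
      _ = ENNReal.ofReal (R / 2 ^ k) * (volume (b k) / volume (b (k + 1))) := by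
          simp only [div_eq_mul_inv]; ring
      _ ≤ ENNReal.ofReal (R / 2 ^ k) * C := by
          gcongr
          exact ENNReal.div_le_of_le_mul hdbl
      _ = C * ENNReal.ofReal (R / 2 ^ k) := mul_comm _ _
  calc ∫⁻ y in ccBall X Ω₀ x (ENNReal.ofReal R), ccKernel X Ω₀ x y
      ≤ ∫⁻ y in (⋂ k, b k) ∪ ⋃ k, b k \ b (k + 1), ccKernel X Ω₀ x y := lintegral_mono_set hcover
    _ ≤ 0 + ∑' k, ∫⁻ y in b k \ b (k + 1), ccKernel X Ω₀ x y := by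
        refine (lintegral_union_le _ _ _).trans (add_le_add hzero.le (lintegral_iUnion_le _ _))
    _ ≤ ∑' k, C * (ENNReal.ofReal R * (2⁻¹) ^ k) := by
        rw [zero_add]
        exact ENNReal.tsum_le_tsum hann
    _ = C * (ENNReal.ofReal R * 2) := by
        rw [ENNReal.tsum_mul_left, ENNReal.tsum_mul_left, ENNReal.tsum_geometric_two]

/-- The kernel is symmetric up to the doubling constant, since
`B_d(y, d(x, y)) ⊆ B_d(x, 2 d(x, y))`. -/
lemma ccKernel_le_mul_swap (h1 : CondH1 X Ω₀) {x y : E n} (hx : x ∈ Ω₀) (hy : y ∈ Ω₀) {R : ℝ}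
    (hxy : ccDist X x y < ENNReal.ofReal R) {C : ℝ≥0∞} (hC0 : C ≠ 0) (hCt : C ≠ ∞)
    (hC : ∀ r : ℝ, 0 < r → r < R → volume (ccBall X Ω₀ x (ENNReal.ofReal (2 * r))) ≤
      C * volume (ccBall X Ω₀ x (ENNReal.ofReal r))) :
    ccKernel X Ω₀ x y ≤ C * ccKernel X Ω₀ y x := by
  by_cases h0 : ccDist X x y = 0
  · simp [ccKernel, h0]
  have hfin := (h1.1 x hx y hy).ne
  have htop : ENNReal.ofReal (ccDist X x y).toReal = ccDist X x y := ENNReal.ofReal_toReal hfin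
  have hd := hC _ (ENNReal.toReal_pos h0 hfin) (by
    rw [← htop] at hxy
    exact (ENNReal.ofReal_lt_ofReal_iff_of_nonneg ENNReal.toReal_nonneg).1 hxy)
  rw [ENNReal.ofReal_mul (by norm_num), htop] at hd
  have hsub : volume (ccBall X Ω₀ y (ccDist X x y)) ≤
      volume (ccBall X Ω₀ x (ENNReal.ofReal 2 * ccDist X x y)) := by
    refine measure_mono fun z hz => ⟨hz.1, (ccDist_triangle x y z).trans_lt ?_⟩
    rw [show ENNReal.ofReal 2 = 2 by simp, two_mul]
    exact ENNReal.add_lt_add_left hfin hz.2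
  simp only [ccKernel]
  rw [ccDist_comm y x, div_eq_mul_inv, div_eq_mul_inv, mul_left_comm]
  gcongr
  rw [← ENNReal.inv_le_inv, inv_inv, ENNReal.mul_inv (Or.inl hC0) (Or.inl hCt), inv_inv, mul_comm,
    ← div_eq_mul_inv]
  exact ENNReal.div_le_of_le_mul (by rw [mul_comm]; exact hsub.trans hd)

lemma continuousOn_classicalGrad (hX : ∀ j, ContinuousOn (X j) Ω₀) {u : E n → ℝ}
    (hu : ContDiff ℝ 1 u) : ContinuousOn (classicalGrad X u) Ω₀ := by
  refine (PiLp.continuous_toLp 2 _).comp_continuousOn (continuousOn_pi.2 fun j => ?_)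
  exact (hu.continuous_fderiv (by norm_num)).continuousOn.clm_apply (hX j)

/-! ### The local Poincaré inequality -/

/-- **Local Poincaré inequality**: every point of `Ω₀` has an open neighbourhood on which the
oscillation of `u` in `L^p` is controlled by `Xu`. -/
lemma exists_local_poincare (hΩ₀ : IsOpen Ω₀) (hX : ∀ j, ContinuousOn (X j) Ω₀)
    (h1 : CondH1 X Ω₀) (h2 : CondH2 X Ω₀) (h3 : CondH3 X Ω₀) {p : ℝ} (hp : 1 ≤ p) {x₀ : E n}
    (hx₀ : x₀ ∈ Ω₀) :
    ∃ B : Set (E n), IsOpen B ∧ x₀ ∈ B ∧ volume B ≠ ∞ ∧ ∃ C : ℝ≥0∞, C ≠ ∞ ∧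
      ∀ u : E n → ℝ, ContDiff ℝ 1 u → HasCompactSupport u → ∃ a : ℝ,
        ∫⁻ x in B, ‖u x - a‖ₑ ^ p ≤ C * ∫⁻ x in Ω₀, ‖classicalGrad X u x‖ₑ ^ p := by
  have hp0 : 0 ≤ p := by linarith
  obtain ⟨ρ, hρ, hρΩ⟩ := Metric.nhds_basis_closedBall.mem_iff.1 (hΩ₀.mem_nhds hx₀)
  obtain ⟨δ, hδ, hδρ⟩ := exists_ccBall_subset (X := X) hρ fun j => (hX j).mono hρΩ
  obtain ⟨rK, hrK, CK, hCK, hdbl⟩ := h2 _ (isCompact_closedBall x₀ ρ) hρΩ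
  obtain ⟨c, C, hc, hC, hrep⟩ := h3
  -- `B` and `cB` lie in the compact ball, and `d < r + c r ≤ rK` between their points
  obtain ⟨r, hr, hrδ, hcr, hrr⟩ : ∃ r : ℝ, 0 < r ∧ r ≤ δ ∧ c * r ≤ δ ∧ r + c * r ≤ rK := by
    refine ⟨min δ rK / (1 + c), by positivity, ?_, ?_, ?_⟩
    · exact (div_le_self (by positivity) (by linarith)).trans (min_le_left _ _)
    · rw [mul_div_assoc', div_le_iff₀ (by positivity)]
      nlinarith [min_le_left δ rK]
    · rw [← one_add_mul, mul_div_cancel₀ _ (by positivity)]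
      exact min_le_right _ _
  set B := ccBall X Ω₀ x₀ (ENNReal.ofReal r) with hB
  set cB := ccBall X Ω₀ x₀ (ENNReal.ofReal (c * r)) with hcB
  have hBΩ : B ⊆ Ω₀ := fun y hy => hy.1
  have hcBΩ : cB ⊆ Ω₀ := fun y hy => hy.1
  have hBK : B ⊆ Metric.closedBall x₀ ρ := fun y hy =>
    hδρ ⟨trivial, hy.2.trans_le (ENNReal.ofReal_le_ofReal hrδ)⟩
  have hcBK : cB ⊆ Metric.closedBall x₀ ρ := fun y hy =>
    hδρ ⟨trivial, hy.2.trans_le (ENNReal.ofReal_le_ofReal hcr)⟩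
  have hBo : IsOpen B := isOpen_ccBall hΩ₀ h1 hx₀ _
  have hcBo : IsOpen cB := isOpen_ccBall hΩ₀ h1 hx₀ _
  set R := r + c * r with hRdef
  have hR : 0 < R := by positivity
  have hdist : ∀ x ∈ B, ∀ y ∈ cB, ccDist X x y < ENNReal.ofReal R := fun x hx y hy => by
    refine (ccDist_triangle x x₀ y).trans_lt ?_
    rw [hRdef, ENNReal.ofReal_add hr.le (by positivity), ccDist_comm x x₀]
    exact ENNReal.add_lt_add hx.2 hy.2
  set K := ENNReal.ofReal CK with hK
  have hK0 : K ≠ 0 := by simpa [hK] using hCK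
  have hKt : K ≠ ∞ := ENNReal.ofReal_ne_top
  have hdbl' : ∀ x ∈ Metric.closedBall x₀ ρ, ∀ r : ℝ, 0 < r → r < R →
      volume (ccBall X Ω₀ x (ENNReal.ofReal (2 * r))) ≤
        K * volume (ccBall X Ω₀ x (ENNReal.ofReal r)) :=
    fun x hx s hs hsR => hdbl x hx s hs (hsR.trans_le hrr)
  set M := (1 + K) * (K * (ENNReal.ofReal R * 2)) with hM
  have hMt : M ≠ ∞ := by finiteness
  have hM₁ : ∀ᵐ x ∂volume.restrict B, ∫⁻ y in cB, ccKernel X Ω₀ x y ≤ M := by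
    filter_upwards [ae_restrict_mem hBo.measurableSet] with x hx
    refine (lintegral_mono_set (fun y hy => ⟨hy.1, hdist x hx y hy⟩ :
      cB ⊆ ccBall X Ω₀ x (ENNReal.ofReal R))).trans
      ((lintegral_ccKernel_le hΩ₀ h1 (hBΩ hx) hR (hdbl' x (hBK hx))).trans ?_)
    rw [hM, add_mul, one_mul]
    exact le_self_add
  have hM₂ : ∀ᵐ y ∂volume.restrict cB, ∫⁻ x in B, ccKernel X Ω₀ x y ≤ M := by
    filter_upwards [ae_restrict_mem hcBo.measurableSet] with y hy
    calc ∫⁻ x in B, ccKernel X Ω₀ x y ≤ ∫⁻ x in B, K * ccKernel X Ω₀ y x :=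
          setLIntegral_mono' hBo.measurableSet fun x hx =>
            ccKernel_le_mul_swap h1 (hBΩ hx) (hcBΩ hy) (hdist x hx y hy) hK0 hKt
              (hdbl' x (hBK hx))
      _ = K * ∫⁻ x in B, ccKernel X Ω₀ y x := lintegral_const_mul' _ _ hKt
      _ ≤ K * (K * (ENNReal.ofReal R * 2)) := by
          gcongr
          have hsub : B ⊆ ccBall X Ω₀ y (ENNReal.ofReal R) := fun x hx =>
            ⟨hx.1, by rw [ccDist_comm]; exact hdist x hx y hy⟩
          exact (lintegral_mono_set hsub).trans
            (lintegral_ccKernel_le hΩ₀ h1 (hcBΩ hy) hR (hdbl' y (hcBK hy)))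
      _ ≤ M := by
          rw [hM, add_mul, one_mul]
          exact le_add_self
  refine ⟨B, hBo, ⟨hx₀, ?_⟩, ?_, ENNReal.ofReal C ^ p * M ^ p, ?_, fun u hu hus =>
    ⟨⨍ y in B, u y, ?_⟩⟩
  · rw [ccDist_self]
    simpa using hr
  · exact ((measure_mono hBK).trans_lt (isCompact_closedBall x₀ ρ).measure_lt_top).ne
  · exact ENNReal.mul_ne_top (ENNReal.rpow_ne_top_of_nonneg hp0 ENNReal.ofReal_ne_top)
      (ENNReal.rpow_ne_top_of_nonneg hp0 hMt)
  · have hCp : ENNReal.ofReal C ^ p ≠ ∞ := ENNReal.rpow_ne_top_of_nonneg hp0 ENNReal.ofReal_ne_top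
    obtain ⟨L, hL⟩ := hu.lipschitzWith_of_hasCompactSupport hus (by norm_num)
    have hsub : ccBall X univ x₀ (ENNReal.ofReal (c * r)) ⊆ Ω₀ := fun y hy =>
      hρΩ (hδρ ⟨trivial, hy.2.trans_le (ENNReal.ofReal_le_ofReal hcr)⟩)
    have hg : AEMeasurable (fun y => ‖classicalGrad X u y‖ₑ) (volume.restrict cB) :=
      (((continuousOn_classicalGrad hX hu).mono hcBΩ).aemeasurable hcBo.measurableSet).enorm
    calc ∫⁻ x in B, ‖u x - ⨍ y in B, u y‖ₑ ^ p
        ≤ ∫⁻ x in B, (ENNReal.ofReal C *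
            ∫⁻ y in cB, ‖classicalGrad X u y‖ₑ * ccKernel X Ω₀ x y) ^ p := by
          refine setLIntegral_mono' hBo.measurableSet fun x hx => ?_
          gcongr
          have := hrep x₀ r hr hsub u ⟨L, hL.lipschitzOnWith⟩ x ⟨subset_closure hx, hBΩ hx⟩
          rwa [← Real.norm_eq_abs, ofReal_norm] at this
      _ = ENNReal.ofReal C ^ p * ∫⁻ x in B,
            (∫⁻ y in cB, ‖classicalGrad X u y‖ₑ * ccKernel X Ω₀ x y) ^ p := by
          simp_rw [ENNReal.mul_rpow_of_nonneg _ _ hp0]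
          rw [lintegral_const_mul' _ _ hCp]
      _ ≤ ENNReal.ofReal C ^ p * (M ^ p * ∫⁻ y in cB, ‖classicalGrad X u y‖ₑ ^ p) := by
          gcongr
          exact lintegral_rpow_lintegral_mul_le (aemeasurable_ccKernel hΩ₀ h1 hBΩ hcBΩ) hg hp hMt
            hM₁ hM₂
      _ ≤ _ := by
          rw [mul_assoc]
          gcongr

/-! ### The inequality for `C¹` functions with compact support -/

/-- An `L^p` bound of the oscillation on `B` and an `L^p` bound on a part `W` of `B` with positive
measure give an `L^p` bound on `B`. -/
lemma lintegral_rpow_le_of_oscillation {α : Type*} [MeasurableSpace α] {μ : Measure α} {p : ℝ}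
    (hp : 1 ≤ p) {B W : Set α} (hWB : W ⊆ B) (hW0 : μ W ≠ 0) (hWt : μ W ≠ ∞) {u : α → ℝ}
    (hu : Measurable u) {a : ℝ} {S T : ℝ≥0∞} (hS : ∫⁻ x in B, ‖u x - a‖ₑ ^ p ∂μ ≤ S)
    (hT : ∫⁻ x in W, ‖u x‖ₑ ^ p ∂μ ≤ T) :
    ∫⁻ x in B, ‖u x‖ₑ ^ p ∂μ ≤ 2 ^ (p - 1) * (S + 2 ^ (p - 1) * (S + T) / μ W * μ B) := by
  have hp0 : 0 ≤ p := by linarith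
  have h2 : (2 : ℝ≥0∞) ^ (p - 1) ≠ ∞ :=
    ENNReal.rpow_ne_top_of_nonneg (by linarith) ENNReal.ofNat_ne_top
  have ha : ‖a‖ₑ ^ p ≤ 2 ^ (p - 1) * (S + T) / μ W := by
    rw [ENNReal.le_div_iff_mul_le (Or.inl hW0) (Or.inl hWt), ← setLIntegral_const]
    calc ∫⁻ _ in W, ‖a‖ₑ ^ p ∂μ
        ≤ ∫⁻ x in W, 2 ^ (p - 1) * (‖u x - a‖ₑ ^ p + ‖u x‖ₑ ^ p) ∂μ := by
          refine lintegral_mono fun x => ?_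
          refine le_trans ?_ (ENNReal.rpow_add_le_mul_rpow_add_rpow _ _ hp)
          gcongr
          rw [← enorm_neg (u x - a), neg_sub]
          simpa using enorm_add_le (a - u x) (u x)
      _ = 2 ^ (p - 1) * (∫⁻ x in W, ‖u x - a‖ₑ ^ p ∂μ + ∫⁻ x in W, ‖u x‖ₑ ^ p ∂μ) := by
          rw [lintegral_const_mul' _ _ h2, lintegral_add_left (by fun_prop)]
      _ ≤ 2 ^ (p - 1) * (S + T) := by
          gcongr
          exact (lintegral_mono_set hWB).trans hS
  calc ∫⁻ x in B, ‖u x‖ₑ ^ p ∂μ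
      ≤ ∫⁻ x in B, 2 ^ (p - 1) * (‖u x - a‖ₑ ^ p + ‖a‖ₑ ^ p) ∂μ := by
        refine lintegral_mono fun x => ?_
        refine le_trans ?_ (ENNReal.rpow_add_le_mul_rpow_add_rpow _ _ hp)
        gcongr
        simpa using enorm_add_le (u x - a) a
    _ = 2 ^ (p - 1) * (∫⁻ x in B, ‖u x - a‖ₑ ^ p ∂μ + ‖a‖ₑ ^ p * μ B) := by
        rw [lintegral_const_mul' _ _ h2, lintegral_add_left (by fun_prop), setLIntegral_const]
    _ ≤ _ := by gcongr

/-- `u` is a `C¹` function with compact support in `Ω`. -/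
def IsC1c (Ω : Set (E n)) (u : E n → ℝ) : Prop :=
  ContDiff ℝ 1 u ∧ HasCompactSupport u ∧ tsupport u ⊆ Ω

/-- On `V`, the `L^p` norm of every `u ∈ C¹_c(Ω)` is controlled by that of `Xu` on `Ω`. -/
def HasBoundOn (X : Fin m → E n → E n) (Ω : Set (E n)) (p : ℝ) (V : Set (E n)) : Prop :=
  ∃ C : ℝ≥0∞, C ≠ ∞ ∧ ∀ u : E n → ℝ, IsC1c Ω u →
    ∫⁻ x in V, ‖u x‖ₑ ^ p ≤ C * ∫⁻ x in Ω, ‖classicalGrad X u x‖ₑ ^ p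

lemma HasBoundOn.mono {p : ℝ} {V W : Set (E n)} (h : HasBoundOn X Ω p W) (hVW : V ⊆ W) :
    HasBoundOn X Ω p V := by
  obtain ⟨C, hC, hu⟩ := h
  exact ⟨C, hC, fun u h => (lintegral_mono_set hVW).trans (hu u h)⟩

lemma HasBoundOn.union {p : ℝ} {V W : Set (E n)} (hV : HasBoundOn X Ω p V)
    (hW : HasBoundOn X Ω p W) : HasBoundOn X Ω p (V ∪ W) := by
  obtain ⟨C, hC, hu⟩ := hV
  obtain ⟨D, hD, hv⟩ := hW
  refine ⟨C + D, ENNReal.add_ne_top.2 ⟨hC, hD⟩, fun u h => (lintegral_union_le _ _ _).trans ?_⟩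
  rw [add_mul]
  exact add_le_add (hu u h) (hv u h)

lemma hasBoundOn_empty {p : ℝ} : HasBoundOn X Ω p ∅ := ⟨0, by simp, fun u _ => by simp⟩

lemma classicalGrad_eq_zero {u : E n → ℝ} {x : E n} (hx : x ∉ tsupport u) :
    classicalGrad X u x = 0 := by
  have : fderiv ℝ u x = 0 := by
    by_contra h
    exact hx (support_fderiv_subset ℝ h)
  ext j
  simp [classicalGrad, this]

lemma lintegral_classicalGrad_le {p : ℝ} (hp : 0 < p) (hΩ : IsOpen Ω) {u : E n → ℝ}
    (hu : tsupport u ⊆ Ω) :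
    ∫⁻ x in Ω₀, ‖classicalGrad X u x‖ₑ ^ p ≤ ∫⁻ x in Ω, ‖classicalGrad X u x‖ₑ ^ p := by
  refine (setLIntegral_le_lintegral _ _).trans ?_
  rw [← lintegral_indicator hΩ.measurableSet, indicator_eq_self.2]
  intro x hx
  by_contra hxΩ
  refine hx ?_
  simp [classicalGrad_eq_zero (X := X) fun h => hxΩ (hu h), hp]

/-- The bound spreads through the neighbourhoods of the local Poincaré inequality: if it holds on
an open set that meets such a neighbourhood, then it holds on the neighbourhood. -/
lemma HasBoundOn.of_local_poincare {p : ℝ} (hp : 1 ≤ p) (hΩ : IsOpen Ω) {B W : Set (E n)}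
    (hBt : volume B ≠ ∞) {C : ℝ≥0∞} (hC : C ≠ ∞)
    (hB : ∀ u : E n → ℝ, ContDiff ℝ 1 u → HasCompactSupport u → ∃ a : ℝ,
      ∫⁻ x in B, ‖u x - a‖ₑ ^ p ≤ C * ∫⁻ x in Ω₀, ‖classicalGrad X u x‖ₑ ^ p)
    (hWB : W ⊆ B) (hWo : IsOpen W) (hWne : W.Nonempty) (hW : HasBoundOn X Ω p W) :
    HasBoundOn X Ω p B := by
  obtain ⟨D, hD, hDu⟩ := hW
  have hW0 : volume W ≠ 0 := (hWo.measure_pos volume hWne).ne'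
  have hWt : volume W ≠ ∞ := ((measure_mono hWB).trans_lt hBt.lt_top).ne
  have h2 : (2 : ℝ≥0∞) ^ (p - 1) ≠ ∞ :=
    ENNReal.rpow_ne_top_of_nonneg (by linarith) ENNReal.ofNat_ne_top
  refine ⟨2 ^ (p - 1) * (C + 2 ^ (p - 1) * (C + D) / volume W * volume B), ?_, fun u hu => ?_⟩
  · refine ENNReal.mul_ne_top h2 (ENNReal.add_ne_top.2 ⟨hC, ENNReal.mul_ne_top ?_ hBt⟩)
    exact ENNReal.div_ne_top (ENNReal.mul_ne_top h2 (ENNReal.add_ne_top.2 ⟨hC, hD⟩)) hW0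
  · obtain ⟨a, ha⟩ := hB u hu.1 hu.2.1
    have ha' := ha.trans (mul_le_mul_right
      (lintegral_classicalGrad_le (by linarith) hΩ hu.2.2) C)
    refine (lintegral_rpow_le_of_oscillation hp hWB hW0 hWt hu.1.continuous.measurable ha'
      (hDu u hu)).trans (le_of_eq ?_)
    simp only [div_eq_mul_inv]
    ring

/-- The inequality for `C¹_c(Ω)`. The set of points near which the bound holds is open, it is
relatively closed in `closure Ω` by the local Poincaré inequality, and it contains the boundary
points of `closure Ω`, because `u` vanishes on the nonempty open set `B \ closure Ω` if `B` is a
neighbourhood of such a point. -/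
lemma hasBoundOn_closure (hn : 1 ≤ n) {p : ℝ} (hp : 1 ≤ p) (hΩ : IsOpen Ω)
    (hΩb : Bornology.IsBounded Ω) (hΩc : IsConnected Ω) (hΩ₀ : IsOpen Ω₀) (hΩΩ₀ : closure Ω ⊆ Ω₀)
    (hX : ∀ j, ContinuousOn (X j) Ω₀) (h1 : CondH1 X Ω₀) (h2 : CondH2 X Ω₀) (h3 : CondH3 X Ω₀) :
    HasBoundOn X Ω p (closure Ω) := by
  have hcpt : IsCompact (closure Ω) := hΩb.isCompact_closure
  have : Nonempty (Fin n) := ⟨⟨0, hn⟩⟩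
  have : NoncompactSpace (E n) := NormedSpace.noncompactSpace ℝ (E n)
  let G : Set (E n) := {x | ∃ V ∈ 𝓝 x, HasBoundOn X Ω p V}
  have hG : IsOpen G := by
    refine isOpen_iff_mem_nhds.2 fun x ⟨V, hV, hb⟩ => ?_
    filter_upwards [eventually_mem_nhds_iff.2 hV] with y hy using ⟨V, hy, hb⟩
  have hsub : closure Ω ⊆ G := by
    refine hΩc.isPreconnected.closure.subset_of_closure_inter_subset hG ?_ ?_
    · obtain ⟨x, hx⟩ : (frontier (closure Ω)).Nonempty :=
        nonempty_frontier_iff.2 ⟨hΩc.nonempty.closure, hcpt.ne_univ⟩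
      have hxc : x ∈ closure Ω := isClosed_closure.frontier_subset hx
      obtain ⟨B, hBo, hxB, hBt, C, hC, hB⟩ :=
        exists_local_poincare hΩ₀ hX h1 h2 h3 hp (hΩΩ₀ hxc)
      refine ⟨x, hxc, B, hBo.mem_nhds hxB, ?_⟩
      have hne : (B ∩ (closure Ω)ᶜ).Nonempty := by
        rw [frontier_eq_closure_inter_closure] at hx
        exact mem_closure_iff.1 hx.2 B hBo hxB
      have hWo : IsOpen (B ∩ (closure Ω)ᶜ) := hBo.inter isClosed_closure.isOpen_compl
      refine HasBoundOn.of_local_poincare hp hΩ hBt hC hB inter_subset_left hWo hne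
        ⟨0, by simp, fun u hu => ?_⟩
      rw [zero_mul]
      refine (setLIntegral_mono' hWo.measurableSet (g := fun _ => 0) fun x hx => ?_).trans
        (by simp)
      have : u x = 0 := image_eq_zero_of_notMem_tsupport fun h =>
        hx.2 (subset_closure (hu.2.2 h))
      rw [this, enorm_zero, ENNReal.zero_rpow_of_pos (by linarith)]
    · rintro x ⟨hxG, hxc⟩
      obtain ⟨B, hBo, hxB, hBt, C, hC, hB⟩ :=
        exists_local_poincare hΩ₀ hX h1 h2 h3 hp (hΩΩ₀ hxc)
      obtain ⟨y, hyB, V, hV, hb⟩ := mem_closure_iff.1 hxG B hBo hxB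
      exact ⟨B, hBo.mem_nhds hxB, HasBoundOn.of_local_poincare hp hΩ hBt hC hB inter_subset_left
        (hBo.inter isOpen_interior) ⟨y, hyB, mem_interior_iff_mem_nhds.2 hV⟩
        (hb.mono (inter_subset_right.trans interior_subset))⟩
  refine hcpt.induction_on hasBoundOn_empty (fun _ _ hst ht => ht.mono hst)
    (fun _ _ hs ht => hs.union ht) fun x hx => ?_
  obtain ⟨V, hV, hb⟩ := hsub hx
  exact ⟨V, mem_nhdsWithin_of_mem_nhds hV, hb⟩

/-! ### Weak gradients -/

/-- The operator on test functions that defines `Xⱼu` by duality, up to sign: the divergence of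
`ψ Xⱼ`. -/
noncomputable def testDiv (X : Fin m → E n → E n) (ψ : E n → ℝ) (j : Fin m) (x : E n) : ℝ :=
  ∑ i : Fin n, fderiv ℝ (fun y => X j y i * ψ y) x (EuclideanSpace.single i 1)

/-- The product is Lipschitz on the whole space although `f` is arbitrary outside `A`: `f` may be
replaced by a Lipschitz extension of `f|_A`, and it is bounded on the support of `ψ`. -/
lemma exists_lipschitzWith_mul {F : Type*} [PseudoMetricSpace F] {A : Set F} {L L' : ℝ≥0}
    {f ψ : F → ℝ} (hf : LipschitzOnWith L f A) (hψ : LipschitzWith L' ψ)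
    (hψc : HasCompactSupport ψ) (hψA : tsupport ψ ⊆ A) :
    ∃ K : ℝ≥0, LipschitzWith K (fun y => f y * ψ y) := by
  obtain ⟨g, hg, hfg⟩ := hf.extend_real
  obtain ⟨M, hM⟩ := hψc.isCompact.exists_bound_of_continuousOn hg.continuous.continuousOn
  obtain ⟨N, hN⟩ := hψc.isCompact.exists_bound_of_continuousOn hψ.continuous.continuousOn
  have heq : (fun y => f y * ψ y) = fun y => g y * ψ y := by
    ext y
    by_cases hy : y ∈ tsupport ψ
    · rw [hfg (hψA hy)]
    · simp [image_eq_zero_of_notMem_tsupport hy]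
  rw [heq]
  have key : ∀ x ∈ tsupport ψ, ∀ y, |g x * ψ x - g y * ψ y| ≤
      (max M 0 * L' + max N 0 * L) * dist x y := fun x hx y => by
    have hg' := hg.dist_le_mul x y
    have hψ' := hψ.dist_le_mul x y
    rw [Real.dist_eq] at hg' hψ'
    have hMx : |g x| ≤ max M 0 := (hM x hx).trans (le_max_left _ _)
    have hNy : |ψ y| ≤ max N 0 := by
      by_cases hy : y ∈ tsupport ψ
      · exact (hN y hy).trans (le_max_left _ _)
      · simp [image_eq_zero_of_notMem_tsupport hy]
    calc |g x * ψ x - g y * ψ y| = |g x * (ψ x - ψ y) + ψ y * (g x - g y)| := by ring_nf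
      _ ≤ |g x| * |ψ x - ψ y| + |ψ y| * |g x - g y| := by
          rw [← abs_mul, ← abs_mul]
          exact abs_add_le _ _
      _ ≤ max M 0 * (L' * dist x y) + max N 0 * (L * dist x y) := by gcongr
      _ = _ := by ring
  refine ⟨(max M 0 * L' + max N 0 * L).toNNReal, LipschitzWith.of_dist_le_mul fun x y => ?_⟩
  rw [Real.coe_toNNReal _ (by positivity), Real.dist_eq]
  by_cases hx : x ∈ tsupport ψ
  · exact key x hx y
  by_cases hy : y ∈ tsupport ψ
  · rw [abs_sub_comm, dist_comm]
    exact key y hy x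
  · rw [image_eq_zero_of_notMem_tsupport hx, image_eq_zero_of_notMem_tsupport hy]
    simp only [mul_zero, sub_zero, abs_zero]
    positivity

lemma exists_lipschitzWith_coord_mul (hX : ∀ j, ∃ L : ℝ≥0, LipschitzOnWith L (X j) Ω₀)
    (hΩ : Ω ⊆ Ω₀) {ψ : E n → ℝ} {k : WithTop ℕ∞} (hψ : ContDiff ℝ k ψ) (hk : k ≠ 0)
    (hψc : HasCompactSupport ψ) (hψΩ : tsupport ψ ⊆ Ω) (j : Fin m) (i : Fin n) :
    ∃ K : ℝ≥0, LipschitzWith K (fun y => X j y i * ψ y) := by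
  obtain ⟨L, hL⟩ := hX j
  obtain ⟨L', hL'⟩ := hψ.lipschitzWith_of_hasCompactSupport hψc hk
  exact exists_lipschitzWith_mul
    ((EuclideanSpace.proj i : E n →L[ℝ] ℝ).lipschitz.comp_lipschitzOnWith hL)
    hL' hψc (hψΩ.trans hΩ)

lemma integrableOn_mul_of_bounded {w h : E n → ℝ} (hw : LocallyIntegrableOn w Ω)
    (hΩ : MeasurableSet Ω) {K : Set (E n)} (hK : IsCompact K) (hKΩ : K ⊆ Ω) (hh : Measurable h)
    {C : ℝ} (hC : ∀ x, ‖h x‖ ≤ C) (h0 : ∀ x ∉ K, h x = 0) :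
    IntegrableOn (fun x => w x * h x) Ω := by
  have hwK : IntegrableOn w K := hw.integrableOn_compact_subset hKΩ hK
  have : IntegrableOn (fun x => w x * h x) K :=
    Integrable.mul_bdd (c := C) hwK hh.aestronglyMeasurable (Filter.Eventually.of_forall hC)
  exact this.of_forall_sdiff_eq_zero hΩ fun x hx => by rw [h0 x hx.2, mul_zero]

lemma fderiv_mul_eq_zero {f ψ : E n → ℝ} {x : E n} (hx : x ∉ tsupport ψ) :
    fderiv ℝ (fun y => f y * ψ y) x = 0 := by
  by_contra h
  exact hx (closure_mono (Function.support_mul_subset_right f ψ) (support_fderiv_subset ℝ h))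

lemma integrableOn_mul_testDiv (hX : ∀ j, ∃ L : ℝ≥0, LipschitzOnWith L (X j) Ω₀)
    (hΩ : Ω ⊆ Ω₀) (hΩm : MeasurableSet Ω) {ψ : E n → ℝ} (hψ : ContDiff ℝ (⊤ : ℕ∞) ψ)
    (hψc : HasCompactSupport ψ) (hψΩ : tsupport ψ ⊆ Ω) {w : E n → ℝ}
    (hw : LocallyIntegrableOn w Ω) (j : Fin m) :
    IntegrableOn (fun x => w x * testDiv X ψ j x) Ω := by
  choose K hK using exists_lipschitzWith_coord_mul hX hΩ hψ (by simp) hψc hψΩ j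
  refine integrableOn_mul_of_bounded hw hΩm hψc.isCompact hψΩ ?_ (C := ∑ i, (K i : ℝ)) ?_ ?_
  · exact Finset.measurable_fun_sum _ fun i _ => measurable_fderiv_apply_const ℝ _ _
  · intro x
    refine (norm_sum_le _ _).trans (Finset.sum_le_sum fun i _ => ?_)
    refine (ContinuousLinearMap.le_opNorm _ _).trans ?_
    simpa using norm_fderiv_le_of_lipschitz ℝ (hK i)
  · intro x hx
    simp [testDiv, fderiv_mul_eq_zero hx]

lemma integrableOn_coord_mul_test (hΩm : MeasurableSet Ω) {ψ : E n → ℝ}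
    (hψ : ContDiff ℝ (⊤ : ℕ∞) ψ) (hψc : HasCompactSupport ψ) (hψΩ : tsupport ψ ⊆ Ω)
    {V : E n → E m} (hV : LocallyIntegrableOn V Ω) (j : Fin m) :
    IntegrableOn (fun x => V x j * ψ x) Ω := by
  obtain ⟨C, hC⟩ := hψ.continuous.bounded_above_of_compact_support hψc
  have hVj : LocallyIntegrableOn (fun x => V x j) Ω := fun x hx => by
    obtain ⟨s, hs, hi⟩ := hV x hx
    exact ⟨s, hs, (EuclideanSpace.proj j : E m →L[ℝ] ℝ).integrable_comp hi⟩
  exact integrableOn_mul_of_bounded hVj hΩm hψc.isCompact hψΩ hψ.continuous.measurable hC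
    fun x hx => image_eq_zero_of_notMem_tsupport hx

lemma IsWeakGrad.sub (hX : ∀ j, ∃ L : ℝ≥0, LipschitzOnWith L (X j) Ω₀)
    (hΩ : Ω ⊆ Ω₀) (hΩm : MeasurableSet Ω) {u v : E n → ℝ} {U V : E n → E m}
    (hu : IsWeakGrad X Ω u U) (hv : IsWeakGrad X Ω v V) :
    IsWeakGrad X Ω (fun x => u x - v x) (fun x => U x - V x) := by
  refine ⟨hu.locInt.sub hv.locInt, hu.locInt_grad.sub hv.locInt_grad, fun ψ hψ hψc hψΩ j => ?_⟩
  have e₁ := hu.integral_eq ψ hψ hψc hψΩ j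
  have e₂ := hv.integral_eq ψ hψ hψc hψΩ j
  have i₁ := integrableOn_mul_testDiv hX hΩ hΩm hψ hψc hψΩ hu.locInt j
  have i₂ := integrableOn_mul_testDiv hX hΩ hΩm hψ hψc hψΩ hv.locInt j
  simp only [PiLp.sub_apply, sub_mul]
  simp only [testDiv] at i₁ i₂
  rw [integral_sub (integrableOn_coord_mul_test hΩm hψ hψc hψΩ hu.locInt_grad j)
    (integrableOn_coord_mul_test hΩm hψ hψc hψΩ hv.locInt_grad j), integral_sub i₁ i₂, e₁, e₂]
  ring

lemma IsWeakGrad.ae_eq (hΩ : IsOpen Ω) {u : E n → ℝ} {U V : E n → E m}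
    (hU : IsWeakGrad X Ω u U) (hV : IsWeakGrad X Ω u V) : U =ᵐ[volume.restrict Ω] V := by
  have h : ∀ j : Fin m, ∀ᵐ x, x ∈ Ω → U x j - V x j = 0 := fun j => by
    refine hΩ.ae_eq_zero_of_integral_contDiff_smul_eq_zero (fun x hx => ?_)
      fun ψ hψ hψc hψΩ => ?_
    · obtain ⟨s, hs, hi⟩ := hU.locInt_grad.sub hV.locInt_grad x hx
      exact ⟨s, hs, (EuclideanSpace.proj j : E m →L[ℝ] ℝ).integrable_comp hi⟩
    · have e₁ := hU.integral_eq ψ hψ hψc hψΩ j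
      have e₂ := hV.integral_eq ψ hψ hψc hψΩ j
      rw [← setIntegral_eq_integral_of_forall_compl_eq_zero (s := Ω) fun x hx => by
        rw [image_eq_zero_of_notMem_tsupport fun h => hx (hψΩ h), zero_smul]]
      simp only [smul_eq_mul, mul_comm (ψ _), sub_mul]
      rw [integral_sub (integrableOn_coord_mul_test hΩ.measurableSet hψ hψc hψΩ hU.locInt_grad j)
        (integrableOn_coord_mul_test hΩ.measurableSet hψ hψc hψΩ hV.locInt_grad j), e₁, e₂,
        sub_self]
  refine (ae_restrict_iff' hΩ.measurableSet).2 ?_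
  filter_upwards [ae_all_iff.2 h] with x hx hxΩ
  ext j
  exact sub_eq_zero.1 (hx j hxΩ)

lemma isWeakGrad_weakGrad {u : E n → ℝ} {V : E n → E m} (h : IsWeakGrad X Ω u V) :
    IsWeakGrad X Ω u (weakGrad X Ω u) := by
  have hex : ∃ V : E n → E m, IsWeakGrad X Ω u V := ⟨V, h⟩
  rw [weakGrad, dif_pos hex]
  exact hex.choose_spec

/-- Integration by parts: the classical gradient of a `C¹` function with compact support is its
weak gradient. -/
lemma isWeakGrad_classicalGrad (hX : ∀ j, ∃ L : ℝ≥0, LipschitzOnWith L (X j) Ω₀)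
    (hΩΩ₀ : Ω ⊆ Ω₀) (hΩ : IsOpen Ω) {φ : E n → ℝ} (hφ : IsC1c Ω φ) :
    IsWeakGrad X Ω φ (classicalGrad X φ) := by
  obtain ⟨hφ1, hφc, hφΩ⟩ := hφ
  have hXc : ∀ j, ContinuousOn (X j) Ω := fun j => by
    obtain ⟨L, hL⟩ := hX j
    exact hL.continuousOn.mono hΩΩ₀
  refine ⟨hφ1.continuous.locallyIntegrable.locallyIntegrableOn _,
    (continuousOn_classicalGrad hXc hφ1).locallyIntegrableOn hΩ.measurableSet,
    fun ψ hψ hψc hψΩ j => ?_⟩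
  choose K hK using exists_lipschitzWith_coord_mul hX hΩΩ₀ hψ (by simp) hψc hψΩ j
  obtain ⟨L, hL⟩ := hφ1.lipschitzWith_of_hasCompactSupport hφc (by norm_num)
  set e : Fin n → E n := fun i => EuclideanSpace.single i 1 with he
  rw [setIntegral_eq_integral_of_forall_compl_eq_zero fun x hx => by
      rw [image_eq_zero_of_notMem_tsupport fun h => hx (hψΩ h), mul_zero],
    setIntegral_eq_integral_of_forall_compl_eq_zero fun x hx => by
      rw [image_eq_zero_of_notMem_tsupport fun h => hx (hφΩ h), zero_mul]]
  have hexp : ∀ x, classicalGrad X φ x j * ψ x =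
      ∑ i, lineDeriv ℝ φ x (e i) * (X j x i * ψ x) := fun x => by
    have hsum : X j x = ∑ i, X j x i • e i := by
      simpa [he] using ((EuclideanSpace.basisFun (Fin n) ℝ).sum_repr (X j x)).symm
    have hd : DifferentiableAt ℝ φ x := hφ1.differentiable (by norm_num) x
    change fderiv ℝ φ x (X j x) * ψ x = _
    nth_rewrite 1 [hsum]
    rw [map_sum, Finset.sum_mul]
    refine Finset.sum_congr rfl fun i _ => ?_
    rw [hd.lineDeriv_eq_fderiv, map_smul, smul_eq_mul]
    ring
  have hint₁ : ∀ i, Integrable (fun x => lineDeriv ℝ φ x (e i) * (X j x i * ψ x)) := fun i => by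
    have hd : ∀ x, lineDeriv ℝ φ x (e i) = fderiv ℝ φ x (e i) := fun x =>
      (hφ1.differentiable (by norm_num) x).lineDeriv_eq_fderiv
    simp only [hd]
    refine Continuous.integrable_of_hasCompactSupport ?_ ?_
    · exact ((hφ1.continuous_fderiv (by norm_num)).clm_apply continuous_const).mul (hK i).continuous
    · exact (hψc.mul_left (f := fun x => X j x i)).mul_left
  have hint₂ : ∀ i, Integrable
      (fun x => φ x * fderiv ℝ (fun y => X j y i * ψ y) x (e i)) := fun i => by
    refine Integrable.mul_bdd (c := K i) (hφ1.continuous.integrable_of_hasCompactSupport hφc)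
      (measurable_fderiv_apply_const ℝ _ _).aestronglyMeasurable
      (Filter.Eventually.of_forall fun x => ?_)
    refine (ContinuousLinearMap.le_opNorm _ _).trans ?_
    simpa [he] using norm_fderiv_le_of_lipschitz ℝ (hK i)
  simp only [hexp, Finset.mul_sum]
  rw [integral_finsetSum _ fun i _ => hint₁ i, integral_finsetSum _ fun i _ => hint₂ i,
    ← Finset.sum_neg_distrib]
  refine Finset.sum_congr rfl fun i _ => ?_
  rw [hL.integral_lineDeriv_mul_eq (hK i) (hψc.mul_left (f := fun x => X j x i)) (e i),
    ← integral_neg]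
  refine integral_congr_ae ?_
  filter_upwards [(hK i).ae_differentiableAt (μ := volume)] with x hx
  rw [lineDeriv_neg, hx.lineDeriv_eq_fderiv]
  ring

/-! ### Passage to the closure -/

/-- A Friedrichs inequality in `L^p` for `C¹_c(Ω)` extends to `W^{1,p}_{X,0}(Ω)`. -/
lemma integral_rpow_le_of_memW0 (hX : ∀ j, ∃ L : ℝ≥0, LipschitzOnWith L (X j) Ω₀)
    (hΩΩ₀ : Ω ⊆ Ω₀) (hΩ : IsOpen Ω) {p : ℝ} (hp : 1 ≤ p) {C : ℝ} (hC : 0 ≤ C)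
    (h : ∀ φ, IsC1c Ω φ → eLpNorm φ (ENNReal.ofReal p) (volume.restrict Ω) ≤
      ENNReal.ofReal C * eLpNorm (classicalGrad X φ) (ENNReal.ofReal p) (volume.restrict Ω))
    {u : E n → ℝ} (hu : MemW0 X Ω p u) :
    ∫ x in Ω, |u x| ^ p ≤ C ^ p * ∫ x in Ω, ‖weakGrad X Ω u x‖ ^ p := by
  set μ := volume.restrict Ω with hμ
  set q := ENNReal.ofReal p with hq
  have hp0 : 0 < p := by linarith
  have hqp : q.toReal = p := ENNReal.toReal_ofReal hp0.le
  have hq1 : 1 ≤ q := ENNReal.one_le_ofReal.2 hp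
  have hq0 : q ≠ 0 := (zero_lt_one.trans_le hq1).ne'
  have hqt : q ≠ ∞ := ENNReal.ofReal_ne_top
  obtain ⟨⟨hup, V, hV, hVp⟩, happ⟩ := hu
  set G := weakGrad X Ω u with hG
  have hGw : IsWeakGrad X Ω u G := isWeakGrad_weakGrad hV
  have hGp : MemLp G q μ := hVp.ae_eq (hV.ae_eq hΩ hGw)
  have hI : 0 ≤ ∫ x in Ω, |u x| ^ p := integral_nonneg fun x => by positivity
  have hJ : 0 ≤ ∫ x in Ω, ‖G x‖ ^ p := integral_nonneg fun x => by positivity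
  have hnu := hup.eLpNorm_eq_integral_rpow_norm hq0 hqt
  have hnG := hGp.eLpNorm_eq_integral_rpow_norm hq0 hqt
  rw [hqp] at hnu hnG
  simp only [Real.norm_eq_abs] at hnu
  set a := (∫ x in Ω, |u x| ^ p) ^ p⁻¹ with ha
  set b := (∫ x in Ω, ‖G x‖ ^ p) ^ p⁻¹ with hb
  have ha0 : 0 ≤ a := by positivity
  have hb0 : 0 ≤ b := by positivity
  have key : ∀ ε : ℝ, 0 < ε → a ≤ ε + C * (b + ε) := fun ε hε => by
    obtain ⟨φ, hφ1, hφc, hφΩ, ⟨hφp, W, hW, hWp⟩, hφε⟩ := happ ε hε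
    have hφ : IsC1c Ω φ := ⟨hφ1, hφc, hφΩ⟩
    have hcl := isWeakGrad_classicalGrad hX hΩΩ₀ hΩ hφ
    have hclp : MemLp (classicalGrad X φ) q μ := hWp.ae_eq (hW.ae_eq hΩ hcl)
    have hsub := hGw.sub hX hΩΩ₀ hΩ.measurableSet hcl
    have hae := (isWeakGrad_weakGrad hsub).ae_eq hΩ hsub
    have hnd := (hup.sub hφp).eLpNorm_eq_integral_rpow_norm hq0 hqt
    have hnD := (hGp.sub hclp).eLpNorm_eq_integral_rpow_norm hq0 hqt
    rw [hqp] at hnd hnD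
    simp only [Real.norm_eq_abs, Pi.sub_apply] at hnd hnD
    have hD : ∫ x in Ω, ‖weakGrad X Ω (fun x => u x - φ x) x‖ ^ p =
        ∫ x in Ω, ‖G x - classicalGrad X φ x‖ ^ p :=
      integral_congr_ae (hae.mono fun x hx => by dsimp only; rw [hx])
    rw [normW, hD, one_div] at hφε
    have n1 : 0 ≤ ∫ x in Ω, |u x - φ x| ^ p := integral_nonneg fun x => by positivity
    have n2 : 0 ≤ ∫ x in Ω, ‖G x - classicalGrad X φ x‖ ^ p :=
      integral_nonneg fun x => by positivity
    have d1 : eLpNorm (u - φ) q μ ≤ ENNReal.ofReal ε := by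
      rw [hnd]
      refine ENNReal.ofReal_le_ofReal (le_trans ?_ hφε.le)
      gcongr
      linarith
    have d2 : eLpNorm (G - classicalGrad X φ) q μ ≤ ENNReal.ofReal ε := by
      rw [hnD]
      refine ENNReal.ofReal_le_ofReal (le_trans ?_ hφε.le)
      gcongr
      linarith
    have t1 : eLpNorm u q μ ≤ eLpNorm (u - φ) q μ + eLpNorm φ q μ := by
      simpa using eLpNorm_add_le (hup.sub hφp).1 hφp.1 hq1
    have t2 : eLpNorm (classicalGrad X φ) q μ ≤ eLpNorm G q μ +
        eLpNorm (G - classicalGrad X φ) q μ := by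
      simpa using eLpNorm_sub_le hGp.1 (hGp.sub hclp).1 hq1
    have hfin : ENNReal.ofReal a ≤ ENNReal.ofReal (ε + C * (b + ε)) := by
      rw [ENNReal.ofReal_add hε.le (by positivity), ENNReal.ofReal_mul hC,
        ENNReal.ofReal_add hb0 hε.le, ← hnu, ← hnG]
      refine t1.trans (add_le_add d1 ((h φ hφ).trans ?_))
      gcongr
      exact t2.trans (by gcongr)
    exact (ENNReal.ofReal_le_ofReal_iff (by positivity)).1 hfin
  have hab : a ≤ C * b := by
    refine le_of_forall_pos_le_add fun δ hδ => ?_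
    have := key (δ / (1 + C)) (by positivity)
    have e : δ / (1 + C) + C * (b + δ / (1 + C)) = C * b + δ := by field_simp; ring
    linarith
  have := Real.rpow_le_rpow ha0 hab hp0.le
  rwa [Real.mul_rpow hC hb0, ha, hb, ← Real.rpow_mul hI, ← Real.rpow_mul hJ,
    inv_mul_cancel₀ hp0.ne', Real.rpow_one, Real.rpow_one] at this

end CarnotCaratheodory

theorem proposition2p8 {n m : ℕ} (hn : 1 ≤ n) (p : ℝ) (hp : 1 ≤ p)
    (Ω Ω₀ : Set (EuclideanSpace ℝ (Fin n)))
    (hΩ_open : IsOpen Ω) (hΩ_bdd : Bornology.IsBounded Ω) (hΩ_conn : IsConnected Ω)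
    (hΩ₀_open : IsOpen Ω₀) (hΩΩ₀ : closure Ω ⊆ Ω₀)
    (X : Fin m → EuclideanSpace ℝ (Fin n) → EuclideanSpace ℝ (Fin n))
    (hX : ∀ j, ∃ L : ℝ≥0, LipschitzOnWith L (X j) Ω₀)
    (h1 : CarnotCaratheodory.CondH1 X Ω₀)
    (h2 : CarnotCaratheodory.CondH2 X Ω₀)
    (h3 : CarnotCaratheodory.CondH3 X Ω₀) :
    ∃ c : ℝ, 0 < c ∧ ∀ u : EuclideanSpace ℝ (Fin n) → ℝ,
      CarnotCaratheodory.MemW0 X Ω p u →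
        c * ∫ x in Ω, |u x| ^ p ≤ ∫ x in Ω, ‖CarnotCaratheodory.weakGrad X Ω u x‖ ^ p := by
  have hp0 : 0 < p := by linarith
  have hXc : ∀ j, ContinuousOn (X j) Ω₀ := fun j => by
    obtain ⟨L, hL⟩ := hX j
    exact hL.continuousOn
  obtain ⟨C, hC, hbound⟩ := CarnotCaratheodory.hasBoundOn_closure hn hp hΩ_open hΩ_bdd hΩ_conn
    hΩ₀_open hΩΩ₀ hXc h1 h2 h3
  have hCp : C ^ (1 / p) ≠ ∞ := ENNReal.rpow_ne_top_of_nonneg (by positivity) hC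
  set D := (C ^ (1 / p)).toReal with hD
  have hD0 : 0 ≤ D := ENNReal.toReal_nonneg
  -- adding `1` makes the constant meaningful even if `D = 0`
  refine ⟨1 / (D ^ p + 1), by positivity, fun u hu => ?_⟩
  have := CarnotCaratheodory.integral_rpow_le_of_memW0 hX (subset_closure.trans hΩΩ₀) hΩ_open hp
    hD0 (fun φ hφ => ?_) hu
  · have hJ : 0 ≤ ∫ x in Ω, ‖CarnotCaratheodory.weakGrad X Ω u x‖ ^ p :=
      integral_nonneg fun x => by positivity
    rw [one_div, inv_mul_le_iff₀ (by positivity)]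
    linarith
  · have hq0 : ENNReal.ofReal p ≠ 0 := by simpa using hp0
    rw [eLpNorm_eq_lintegral_rpow_enorm_toReal hq0 ENNReal.ofReal_ne_top,
      eLpNorm_eq_lintegral_rpow_enorm_toReal hq0 ENNReal.ofReal_ne_top,
      ENNReal.toReal_ofReal hp0.le, hD, ENNReal.ofReal_toReal hCp,
      ← ENNReal.mul_rpow_of_nonneg _ _ (by positivity)]
    refine ENNReal.rpow_le_rpow ?_ (by positivity)
    exact (lintegral_mono_set subset_closure).trans (hbound φ hφ)
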